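/- Let $\mathfrak H=\mathbb Q\langle x,y\rangle$ be the non-commutative polynomial algebra, $\mathfrak H^1=\mathbb Q+\mathfrak Hy$, $\mathfrak H^0=\mathbb Q+x\mathfrak Hy$, and let $\check{\mathfrak H}^1\subset\mathfrak H^1$ be the subspace spanned by all words of $\mathfrak H^1$ other than the powers of $y$. Put $z_k=x^{k-1}y$ for $k\ge 1$. For $k_1\ge 2$, $k_2,\dots,k_l\ge 1$ let $$\zeta^\star(k_1,\dots,k_l)=\sum_{m_1\ge\cdots\ge m_l>0}\frac1{m_1^{k_1}\cdots m_l^{k_l}},$$ and let $\overline Z\colon\mathfrak H^0\to\mathbb R$ be the $\mathbb Q$-linear map with $\overline Z(1)=1$ and $\overline Z(z_{k_1}\cdots z_{k_l})=\zeta^\star(k_1,\dots,k_l)$. Let $\gamma$ be the automorphism of $\mathfrak H$ with $\gamma(x)=x$, $\gamma(y)=x+y$, so that $\gamma^{-1}(x)=x$, $\gamma^{-1}(y)=y-x$. For $n\ge 1$ let $\mathfrak H$ act on $\mathfrak H^{\otimes(n+1)}$ by $$a\diamond(w_1\otimes\cdots\otimes w_{n+1})=w_1\otimes\cdots\otimes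 w_n\otimes aw_{n+1},\qquad (w_1\otimes\cdots\otimes w_{n+1})\diamond b=w_1b\otimes w_2\otimes\cdots\otimes w_{n+1},$$ let $\overline{\mathcal C}_n\colon\mathfrak H\to\mathfrak H^{\otimes(n+1)}$ be the unique $\mathbb Q$-linear map with $$\overline{\mathcal C}_n(x)=x\otimes y^{\otimes n},\quad \overline{\mathcal C}_n(y)=-(x\otimes y^{\otimes n}),\quad \overline{\mathcal C}_n(ww')=\overline{\mathcal C}_n(w)\diamond\gamma^{-1}(w')+\gamma^{-1}(w)\diamond\overline{\mathcal C}_n(w')\quad(w,w'\in\mathfrak H),$$ let $M_n\colon\mathfrak H^{\otimes(n+1)}\to\mathfrak H$ be the multiplication map $w_1\otimes\cdots\otimes w_{n+1}\mapsto w_1\cdots w_{n+1}$, and put $\overline\rho_n=M_n\circ\overline{\mathcal C}_n$. (1) For every $n\ge 1$, $\overline\rho_n(\check{\mathfrak H}^1)\subset\ker\overline Z$ (in particular $\overline\rho_n(\check{\mathfrak H}^1)\subset\mathfrak H^0$). (2) For $n=1$ this corresponds to the Ohno–Wakabayashi cyclic sum formula: for all $k_1,\dots,k_l\ge 1$, with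 $k=k_1+\cdots+k_l$, $$\overline\rho_1\bigl(\gamma(z_{k_1}\cdots z_{k_l})-x^{k}\bigr)=\sum_{j=1}^l\sum_{i=1}^{k_j-1}z_{k_j-i+1}z_{k_{j+1}}\cdots z_{k_l}z_{k_1}\cdots z_{k_{j-1}}z_i-k\,z_{k+1},$$ and, if moreover some $k_q>1$, $$\sum_{j=1}^l\sum_{i=1}^{k_j-1}\zeta^\star(k_j-i+1,k_{j+1},\dots,k_l,k_1,\dots,k_{j-1},i)=k\,\zeta(k+1).$$ -/

import Mathlib

open scoped TensorProduct

noncomputable section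

namespace CSF

/-- The two indeterminates. -/
inductive Letter where
  | x : Letter
  | y : Letter

/-- The non-commutative polynomial algebra `ℚ⟨x, y⟩`. -/
abbrev H : Type := FreeAlgebra ℚ Letter

def x : H := FreeAlgebra.ι ℚ Letter.x

def y : H := FreeAlgebra.ι ℚ Letter.y

/-- The monomial of `ℚ⟨x, y⟩` spelled by a list of letters. -/
def word (w : List Letter) : H := (w.map (FreeAlgebra.ι ℚ)).prod

/-- `z_k = x^{k-1} y` (used for `k ≥ 1`). -/
def z (k : ℕ) : H := x ^ (k - 1) * y

/-- `z_{k_1} z_{k_2} ⋯ z_{k_l}`. -/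
def zWord (k : List ℕ) : H := (k.map z).prod

/-- The subspace `ℚ + ℚ⟨x, y⟩ y`. -/
def H1 : Submodule ℚ H := Submodule.span ℚ {1} ⊔ LinearMap.range (LinearMap.mulRight ℚ y)

/-- The subspace `ℚ + x ℚ⟨x, y⟩ y`. -/
def H0 : Submodule ℚ H :=
  Submodule.span ℚ {1} ⊔ LinearMap.range (LinearMap.mulLeft ℚ x ∘ₗ LinearMap.mulRight ℚ y)

/-- The subspace spanned by the words of `ℚ + ℚ⟨x, y⟩ y` that are not powers of `y`. -/
def H1Check : Submodule ℚ H :=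
  Submodule.span ℚ {v : H | v ∈ H1 ∧ (∃ w : List Letter, v = word w) ∧ ∀ m : ℕ, v ≠ y ^ m}

/-- The basis of `ℚ⟨x, y⟩` consisting of the words. -/
def wordBasis : Module.Basis (FreeMonoid Letter) ℚ H := FreeAlgebra.basisFreeMonoid ℚ Letter

theorem wordBasis_apply (w : FreeMonoid Letter) : wordBasis w = word w.toList := by
  simp [wordBasis, FreeAlgebra.basisFreeMonoid, FreeAlgebra.equivMonoidAlgebraFreeMonoid,
    word, FreeMonoid.lift_apply]

/-! ### Multiple zeta-star values -/

/-- `ζ⋆(k_1, …, k_l) = ∑_{m_1 ≥ ⋯ ≥ m_l > 0} m_1^{-k_1} ⋯ m_l^{-k_l}`; the series converges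
when the list is empty, or when all entries are positive and the first one is at least `2`. -/
def zetaStar (k : List ℕ) : ℝ :=
  ∑' m : {m : Fin k.length → ℕ+ // Antitone m}, ∏ i, 1 / ((m.1 i : ℕ) : ℝ) ^ k.get i

/-- Reads the exponents off a word: `x^{k_1-1} y x^{k_2-1} y ⋯ x^{k_l-1} y` gives
`[k_1, …, k_l]`. The first argument counts the letters `x` read since the last `y`. -/
def exponentsAux : ℕ → List Letter → List ℕ
  | _, [] => []
  | c, Letter.x :: w => exponentsAux (c + 1) w
  | c, Letter.y :: w => (c + 1) :: exponentsAux 0 w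

def exponents (w : List Letter) : List ℕ := exponentsAux 0 w

/-- The linear map `Z̄ : ℚ + x ℚ⟨x, y⟩ y → ℝ` with `Z̄(1) = 1` and
`Z̄(x^{k_1-1} y ⋯ x^{k_l-1} y) = ζ⋆(k_1, …, k_l)`. -/
def Zbar : H0 →ₗ[ℚ] ℝ :=
  (wordBasis.constr ℚ (fun w => zetaStar (exponents w.toList))).domRestrict H0

/-! ### The operators -/

/-- The automorphism with `γ(x) = x`, `γ(y) = x + y`; its inverse sends `x` to `x` and `y` to
`y - x`. -/
def γ : H ≃ₐ[ℚ] H :=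
  AlgEquiv.ofAlgHom
    (FreeAlgebra.lift ℚ (fun u => match u with | Letter.x => x | Letter.y => x + y))
    (FreeAlgebra.lift ℚ (fun u => match u with | Letter.x => x | Letter.y => y - x))
    (by ext u; cases u <;> simp [x, y])
    (by ext u; cases u <;> simp [x, y])

/-- The tensor power `ℚ⟨x, y⟩^{⊗ (n+1)}`. -/
abbrev T (n : ℕ) : Type := ⨂[ℚ] _ : Fin (n + 1), H

/-- The left action `a ⋄ (w_1 ⊗ ⋯ ⊗ w_{n+1}) = w_1 ⊗ ⋯ ⊗ w_n ⊗ a w_{n+1}`. -/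
def lact (n : ℕ) : H →ₗ[ℚ] T n →ₗ[ℚ] T n :=
  (PiTensorProduct.mapMultilinear ℚ (fun _ : Fin (n + 1) => H) (fun _ => H)).toLinearMap
    (fun _ => LinearMap.id) (Fin.last n) ∘ₗ LinearMap.mul ℚ H

/-- The right action `(w_1 ⊗ ⋯ ⊗ w_{n+1}) ⋄ b = w_1 b ⊗ w_2 ⊗ ⋯ ⊗ w_{n+1}`, the acting element
being the first argument. -/
def ract (n : ℕ) : H →ₗ[ℚ] T n →ₗ[ℚ] T n :=
  (PiTensorProduct.mapMultilinear ℚ (fun _ : Fin (n + 1) => H) (fun _ => H)).toLinearMap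
    (fun _ => LinearMap.id) 0 ∘ₗ (LinearMap.mul ℚ H).flip

theorem lact_tprod (n : ℕ) (a : H) (w : Fin (n + 1) → H) :
    lact n a (PiTensorProduct.tprod ℚ w) =
      PiTensorProduct.tprod ℚ (Function.update w (Fin.last n) (a * w (Fin.last n))) := by
  simp only [lact, LinearMap.comp_apply, MultilinearMap.toLinearMap_apply,
    PiTensorProduct.mapMultilinear_apply, PiTensorProduct.map_tprod]
  congr 1
  ext i
  by_cases h : i = Fin.last n
  · subst h; simp
  · simp [h]

theorem ract_tprod (n : ℕ) (b : H) (w : Fin (n + 1) → H) :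
    ract n b (PiTensorProduct.tprod ℚ w) =
      PiTensorProduct.tprod ℚ (Function.update w 0 (w 0 * b)) := by
  simp only [ract, LinearMap.comp_apply, MultilinearMap.toLinearMap_apply,
    PiTensorProduct.mapMultilinear_apply, PiTensorProduct.map_tprod]
  congr 1
  ext i
  by_cases h : i = 0
  · subst h; simp
  · simp [h]

theorem lact_mul (n : ℕ) (a b : H) (t : T n) : lact n (a * b) t = lact n a (lact n b t) := by
  suffices h : lact n (a * b) = lact n a ∘ₗ lact n b by rw [h]; rfl
  ext w
  simp [lact_tprod, mul_assoc]

theorem ract_mul (n : ℕ) (a b : H) (t : T n) : ract n (a * b) t = ract n b (ract n a t) := by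
  suffices h : ract n (a * b) = ract n b ∘ₗ ract n a by rw [h]; rfl
  ext w
  simp [ract_tprod, mul_assoc]

theorem lact_ract (n : ℕ) (a b : H) (t : T n) :
    lact n a (ract n b t) = ract n b (lact n a t) := by
  suffices h : lact n a ∘ₗ ract n b = ract n b ∘ₗ lact n a from LinearMap.congr_fun h t
  ext w
  simp only [LinearMap.compMultilinearMap_apply, LinearMap.comp_apply, ract_tprod, lact_tprod]
  congr 1
  ext i
  by_cases h0 : (0 : Fin (n + 1)) = Fin.last n
  · rw [← h0]
    by_cases h : i = 0
    · subst h; simp [mul_assoc]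
    · simp [h]
  · rw [Function.update_of_ne (Ne.symm h0), Function.update_of_ne h0,
      Function.update_comm h0]

theorem lact_one (n : ℕ) (t : T n) : lact n 1 t = t := by
  suffices h : lact n 1 = LinearMap.id by rw [h]; rfl
  ext w
  simp [lact_tprod]

theorem ract_one (n : ℕ) (t : T n) : ract n 1 t = t := by
  suffices h : ract n 1 = LinearMap.id by rw [h]; rfl
  ext w
  simp [ract_tprod]

/-- `x ⊗ y^{⊗ n}`. -/
def xyTensor (n : ℕ) : T n := PiTensorProduct.tprod ℚ (Fin.cons x (fun _ : Fin n => y))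

def CbarLetter (n : ℕ) : Letter → T n
  | Letter.x => xyTensor n
  | Letter.y => -xyTensor n

def CbarWord (n : ℕ) : List Letter → T n
  | [] => 0
  | u :: w =>
      ract n (γ.symm (word w)) (CbarLetter n u) +
        lact n (γ.symm (FreeAlgebra.ι ℚ u)) (CbarWord n w)

/-- The twisted derivation `𝒞̄_n : ℚ⟨x, y⟩ → ℚ⟨x, y⟩^{⊗ (n+1)}`. It is the unique linear map with
`𝒞̄_n(x) = x ⊗ y^{⊗ n}`, `𝒞̄_n(y) = -(x ⊗ y^{⊗ n})` and
`𝒞̄_n(w w') = 𝒞̄_n(w) ⋄ γ⁻¹(w') + γ⁻¹(w) ⋄ 𝒞̄_n(w')`: see `Cbar_x`, `Cbar_y`, `Cbar_mul` and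
`Cbar_unique`. -/
def Cbar (n : ℕ) : H →ₗ[ℚ] T n := wordBasis.constr ℚ (fun w => CbarWord n w.toList)

/-- The multiplication map `w_1 ⊗ ⋯ ⊗ w_{n+1} ↦ w_1 ⋯ w_{n+1}`. -/
def M (n : ℕ) : T n →ₗ[ℚ] H :=
  PiTensorProduct.lift (MultilinearMap.mkPiAlgebraFin ℚ (n + 1) H)

/-- The operator `ρ̄_n = M_n ∘ 𝒞̄_n`. -/
def rhobar (n : ℕ) : H →ₗ[ℚ] H := M n ∘ₗ Cbar n

/-! ### The defining properties of `γ`, `M_n`, `𝒞̄_n` and `Z̄` -/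

theorem γ_x : γ x = x := by simp [γ, x]

theorem γ_y : γ y = x + y := by simp [γ, x, y]

theorem M_tprod (n : ℕ) (w : Fin (n + 1) → H) :
    M n (PiTensorProduct.tprod ℚ w) = (List.ofFn w).prod := by
  simp [M]


theorem Cbar_word (n : ℕ) (w : List Letter) : Cbar n (word w) = CbarWord n w := by
  have h := wordBasis.constr_basis ℚ (fun w => CbarWord n w.toList) (FreeMonoid.ofList w)
  rw [wordBasis_apply] at h
  exact h

theorem word_append (u v : List Letter) : word (u ++ v) = word u * word v := by
  simp [word]

theorem word_cons (a : Letter) (v : List Letter) :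
    word (a :: v) = FreeAlgebra.ι ℚ a * word v := by
  simp [word]

theorem word_nil : word [] = 1 := rfl

theorem Cbar_x (n : ℕ) : Cbar n x = xyTensor n := by
  have h := Cbar_word n [Letter.x]
  simpa [x, y, word, CbarWord, CbarLetter, ract_one] using h

theorem Cbar_y (n : ℕ) : Cbar n y = -xyTensor n := by
  have h := Cbar_word n [Letter.y]
  simpa [x, y, word, CbarWord, CbarLetter, ract_one] using h

theorem CbarWord_append (n : ℕ) (u v : List Letter) :
    CbarWord n (u ++ v) =
      ract n (γ.symm (word v)) (CbarWord n u) + lact n (γ.symm (word u)) (CbarWord n v) := by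
  induction u with
  | nil => simp [CbarWord, word_nil, lact_one]
  | cons a u ih =>
    simp only [List.cons_append, CbarWord, ih, word_append, word_cons, map_mul, map_add,
      ract_mul, lact_mul, lact_ract]
    abel

theorem Cbar_mul (n : ℕ) (w w' : H) :
    Cbar n (w * w') = ract n (γ.symm w') (Cbar n w) + lact n (γ.symm w) (Cbar n w') := by
  let A : H →ₗ[ℚ] H →ₗ[ℚ] T n := (LinearMap.mul ℚ H).compr₂ (Cbar n)
  let B : H →ₗ[ℚ] H →ₗ[ℚ] T n :=
    ((ract n ∘ₗ γ.symm.toLinearMap).flip ∘ₗ Cbar n) +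
      ((lact n ∘ₗ γ.symm.toLinearMap).compl₂ (Cbar n))
  have h : A = B := by
    refine wordBasis.ext fun u => wordBasis.ext fun v => ?_
    simp only [wordBasis_apply]
    change Cbar n (word u.toList * word v.toList) =
      ract n (γ.symm (word v.toList)) (Cbar n (word u.toList)) +
        lact n (γ.symm (word u.toList)) (Cbar n (word v.toList))
    rw [← word_append, Cbar_word, Cbar_word, Cbar_word, CbarWord_append]
  exact LinearMap.congr_fun (LinearMap.congr_fun h w) w'

theorem Cbar_unique (n : ℕ) (C : H →ₗ[ℚ] T n) (hx : C x = xyTensor n) (hy : C y = -xyTensor n)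
    (hmul : ∀ w w' : H, C (w * w') = ract n (γ.symm w') (C w) + lact n (γ.symm w) (C w')) :
    C = Cbar n := by
  have h1 : C 1 = 0 := by
    have h := hmul 1 1
    simpa [ract_one, lact_one] using h
  have hw : ∀ w : List Letter, C (word w) = CbarWord n w := by
    intro w
    induction w with
    | nil => simpa [CbarWord, word_nil] using h1
    | cons a w ih =>
      rw [word_cons, hmul, ih, CbarWord]
      congr 2
      cases a
      · exact hx
      · exact hy
  refine wordBasis.ext fun w => ?_
  rw [wordBasis_apply, hw, Cbar_word]

theorem exponentsAux_replicate (c m : ℕ) (w : List Letter) :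
    exponentsAux c (List.replicate m Letter.x ++ Letter.y :: w) =
      (c + m + 1) :: exponentsAux 0 w := by
  induction m generalizing c with
  | zero => simp [exponentsAux]
  | succ m ih =>
    simp only [List.replicate_succ, List.cons_append, exponentsAux, ih]
    congr 1
    omega

theorem zWord_eq_word (k : List ℕ) (hk : ∀ a ∈ k, 1 ≤ a) :
    ∃ w : List Letter, zWord k = word w ∧ exponents w = k := by
  induction k with
  | nil => exact ⟨[], rfl, rfl⟩
  | cons a k ih =>
    obtain ⟨w, hw, he⟩ := ih fun b hb => hk b (List.mem_cons_of_mem _ hb)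
    have ha : 1 ≤ a := hk a List.mem_cons_self
    refine ⟨List.replicate (a - 1) Letter.x ++ Letter.y :: w, ?_, ?_⟩
    · rw [word_append, word_cons, ← hw]
      simp [zWord, z, word, x, y, mul_assoc]
    · rw [exponents, exponentsAux_replicate]
      rw [exponents] at he
      rw [he]
      congr 1
      omega

theorem Zbar_zWord (k : List ℕ) (hk : ∀ a ∈ k, 1 ≤ a) (h0 : zWord k ∈ H0) :
    Zbar ⟨zWord k, h0⟩ = zetaStar k := by
  obtain ⟨w, hw, he⟩ := zWord_eq_word k hk
  have h := wordBasis.constr_basis ℚ (fun w => zetaStar (exponents w.toList))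
    (FreeMonoid.ofList w)
  rw [wordBasis_apply] at h
  rw [Zbar, LinearMap.domRestrict_apply]
  change wordBasis.constr ℚ (fun w => zetaStar (exponents w.toList)) (zWord k) = _
  rw [hw]
  refine h.trans ?_
  change zetaStar (exponents w) = _
  rw [he]

theorem zetaStar_nil : zetaStar [] = 1 := by
  have : Unique {m : Fin ([] : List ℕ).length → ℕ+ // Antitone m} :=
    { default := ⟨fun i => i.elim0, fun i => i.elim0⟩
      uniq := fun m => Subtype.ext (funext fun i => i.elim0) }
  rw [zetaStar, tsum_eq_single default (fun m hm => absurd (Subsingleton.elim _ _) hm)]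
  rfl

/-- The index `(k_j - i + 1, k_{j+1}, …, k_l, k_1, …, k_{j-1}, i)`, with `j` counted from `0`. -/
def cyclicIndex (k : List ℕ) (j : Fin k.length) (i : ℕ) : List ℕ :=
  (k.get j - i + 1) :: (k.drop (j + 1) ++ k.take j ++ [i])

end CSF

end

/-!
The connected sum of a word attaches to the corresponding strict iterated sum, running from `p` down
to `q < p`, the connector `1 / (p - q)`. Partial fractions for `x`, and a telescoping series for
`y`, show that moving a letter from one end of a word to the other changes the connected sum by
`± ζ(x w y)`, where `w` is the rest of the word. Now `γ⁻¹` turns zeta-star values into zeta values,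
so `Z̄` of `ρ̄_1` of a word is the total change when every letter in turn is moved around. As the
word returns to itself, this is `0` whenever the connected sums converge, and they do as soon as
both letters occur.

Higher `n` reduce to `n = 1`: since `𝒞̄_n` kills `x + y = γ(y)`, one has
`ρ̄_{n+1}(v) = ρ̄_1(v (x + y)^n)`. The cyclic sum formula is the case of
`γ(z_{k_1} ⋯ z_{k_l}) - x^k`, which is a combination of words with both letters because it vanishes
when either letter is set to `0`.
-/

noncomputable section

namespace CSF

open Finset ENNReal

section WordOp

variable {R : Type*} [CommSemiring R]

/-- The operators on sequences attached to the letters: `x` multiplies the `p`-th term by `c p`,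
and `y` replaces it by `c p` times the sum of the terms of index less than `p + s`. The shift `s`
is `0` for the strict sums of multiple zeta values and `1` for the weak sums of multiple zeta-star
values. -/
def letterOp (c : ℕ → R) (s : ℕ) : Letter → Module.End R (ℕ → R)
  | Letter.x =>
    { toFun := fun f p => c p * f p
      map_add' := fun f g => by ext p; simp [mul_add]
      map_smul' := fun a f => by ext p; simp [mul_left_comm] }
  | Letter.y =>
    { toFun := fun f p => c p * ∑ r ∈ range (p + s), f r
      map_add' := fun f g => by ext p; simp [mul_add, sum_add_distrib]
      map_smul' := fun a f => by ext p; simp [mul_left_comm, mul_sum] }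

/-- The composition of the operators `letterOp` along a word. -/
def wordOp (c : ℕ → R) (s : ℕ) (w : List Letter) : Module.End R (ℕ → R) :=
  (w.map (letterOp c s)).prod

variable (c : ℕ → R) (s : ℕ) (f g : ℕ → R)

theorem letterOp_x_apply (p : ℕ) : letterOp c s Letter.x f p = c p * f p := rfl

theorem letterOp_y_apply (p : ℕ) :
    letterOp c s Letter.y f p = c p * ∑ r ∈ range (p + s), f r := rfl

theorem wordOp_nil_apply : wordOp c s [] f = f := by simp [wordOp]

theorem wordOp_cons_apply (u : Letter) (w : List Letter) :
    wordOp c s (u :: w) f = letterOp c s u (wordOp c s w f) := by simp [wordOp]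

theorem wordOp_append_apply (v w : List Letter) :
    wordOp c s (v ++ w) f = wordOp c s v (wordOp c s w f) := by simp [wordOp]

theorem wordOp_singleton_apply (u : Letter) : wordOp c s [u] f = letterOp c s u f := by
  simp [wordOp]

theorem letterOp_one_y : letterOp c 1 Letter.y = letterOp c 0 Letter.y + letterOp c 0 Letter.x := by
  ext f p
  simp [letterOp_x_apply, letterOp_y_apply, sum_range_succ, mul_add]

variable {f g}

theorem wordOp_zero_congr_of_le (w : List Letter) {p : ℕ} (h : ∀ q ≤ p, f q = g q) :
    wordOp c 0 w f p = wordOp c 0 w g p := by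
  induction w generalizing p with
  | nil => simpa only [wordOp_nil_apply] using h p le_rfl
  | cons u w ih =>
    rw [wordOp_cons_apply, wordOp_cons_apply]
    cases u with
    | x => rw [letterOp_x_apply, letterOp_x_apply, ih h]
    | y =>
      rw [letterOp_y_apply, letterOp_y_apply]
      congr 1
      exact sum_congr rfl fun r hr => ih fun q hq => h q (hq.trans (mem_range.1 hr).le)

theorem wordOp_zero_congr_of_lt {w : List Letter} (hw : Letter.y ∈ w) {p : ℕ}
    (h : ∀ q < p, f q = g q) : wordOp c 0 w f p = wordOp c 0 w g p := by
  induction w with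
  | nil => simp at hw
  | cons u w ih =>
    rw [wordOp_cons_apply, wordOp_cons_apply]
    cases u with
    | x => rw [letterOp_x_apply, letterOp_x_apply, ih (by simpa using hw)]
    | y =>
      rw [letterOp_y_apply, letterOp_y_apply]
      congr 1
      exact sum_congr rfl fun r hr =>
        wordOp_zero_congr_of_le c w fun q hq => h q (hq.trans_lt (mem_range.1 hr))

end WordOp

theorem letterOp_mono (c : ℕ → ℝ≥0∞) (s : ℕ) (u : Letter) : Monotone (letterOp c s u) := by
  intro f g h p
  cases u with
  | x => exact mul_le_mul_right (h p) _
  | y => exact mul_le_mul_right (sum_le_sum fun r _ => h r) _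

theorem wordOp_mono (c : ℕ → ℝ≥0∞) (s : ℕ) (w : List Letter) : Monotone (wordOp c s w) := by
  intro f g h
  induction w with
  | nil => simpa only [wordOp_nil_apply] using h
  | cons u w ih =>
    rw [wordOp_cons_apply, wordOp_cons_apply]
    exact letterOp_mono c s u ih

theorem wordOp_tsum {ι : Type*} (c : ℕ → ℝ≥0∞) (s : ℕ) (w : List Letter) (f : ι → ℕ → ℝ≥0∞)
    (p : ℕ) : wordOp c s w (fun q => ∑' i, f i q) p = ∑' i, wordOp c s w (f i) p := by
  induction w generalizing p with
  | nil => simp only [wordOp_nil_apply]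
  | cons u w ih =>
    simp only [wordOp_cons_apply]
    cases u with
    | x => simp only [letterOp_x_apply, ih, ENNReal.tsum_mul_left]
    | y =>
      simp only [letterOp_y_apply, ih, ENNReal.tsum_mul_left]
      rw [Summable.tsum_finsetSum fun _ _ => ENNReal.summable]

/-- The sequence `p ↦ 1 / (p + 1)`: the summation indices `1, 2, …` of zeta values are shifted
to start from `0`. -/
def recip (p : ℕ) : ℝ≥0∞ := ((p + 1 : ℕ) : ℝ≥0∞)⁻¹

/-- The kernel `1 / (p - q)` for `q < p`, extended by `0`. -/
def kern (p q : ℕ) : ℝ≥0∞ := if q < p then ((p - q : ℕ) : ℝ≥0∞)⁻¹ else 0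

/-- The series `∑ f(p) / (p + 1)`. For `f = wordOp recip s w recip` its value is the multiple zeta
value (`s = 0`) or multiple zeta-star value (`s = 1`) of the word `x w y`. -/
def recipSum (f : ℕ → ℝ≥0∞) : ℝ≥0∞ := ∑' p, recip p * f p

/-- The connected sum of a word `w`: the sum over `p` of the strict iterated sum spelled by `w`
that starts at `p` and ends at some `q < p`, weighted by the connector `1 / (p - q)`. -/
def connSum (w : List Letter) : ℝ≥0∞ := ∑' p, wordOp recip 0 w (kern p) p

theorem recipSum_add (f g : ℕ → ℝ≥0∞) : recipSum (f + g) = recipSum f + recipSum g := by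
  simp only [recipSum, Pi.add_apply, mul_add, ENNReal.tsum_add]

theorem recip_eq_ofReal (n : ℕ) : recip n = ENNReal.ofReal (1 / (n + 1)) := by
  rw [recip, one_div, ENNReal.ofReal_inv_of_pos (by positivity)]
  exact_mod_cast congrArg (·⁻¹) (ENNReal.ofReal_natCast (n + 1)).symm

theorem recip_le_one (p : ℕ) : recip p ≤ 1 := by
  rw [recip, ENNReal.inv_le_one]
  exact_mod_cast Nat.le_add_left 1 p

theorem kern_add (q d : ℕ) : kern (q + d + 1) q = recip d := by
  rw [kern, if_pos (by lia), recip, show q + d + 1 - q = d + 1 by lia]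

/-! ### Moving a letter around the connected sum -/

theorem recip_mul_recip_add (q d : ℕ) :
    recip q * recip d = recip (q + d + 1) * recip d + recip (q + d + 1) * recip q := by
  simp only [recip_eq_ofReal]
  rw [← ENNReal.ofReal_mul (by positivity), ← ENNReal.ofReal_mul (by positivity),
    ← ENNReal.ofReal_mul (by positivity), ← ENNReal.ofReal_add (by positivity) (by positivity)]
  congr 1
  push_cast
  field_simp
  ring

theorem recip_mul_kern {p q : ℕ} (h : q < p) :
    recip q * kern p q = recip p * kern p q + recip p * recip q := by
  obtain ⟨d, rfl⟩ := Nat.exists_eq_add_of_lt h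
  rw [kern_add, recip_mul_recip_add]

theorem connSum_append_x {w : List Letter} (hw : Letter.y ∈ w) :
    connSum (w ++ [Letter.x]) = connSum (Letter.x :: w) + recipSum (wordOp recip 0 w recip) := by
  rw [connSum, connSum, recipSum, ← ENNReal.tsum_add]
  refine tsum_congr fun p => ?_
  calc wordOp recip 0 (w ++ [Letter.x]) (kern p) p
      = wordOp recip 0 w (recip p • kern p + recip p • recip) p := by
        rw [wordOp_append_apply, wordOp_singleton_apply]
        exact wordOp_zero_congr_of_lt recip hw fun q hq => recip_mul_kern hq
    _ = recip p * wordOp recip 0 w (kern p) p + recip p * wordOp recip 0 w recip p := by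
        simp only [map_add, map_smul, Pi.add_apply, Pi.smul_apply, smul_eq_mul]
    _ = _ := by rw [wordOp_cons_apply, letterOp_x_apply]

theorem hasSum_sub_add {f : ℕ → ℝ} (hf : Antitone f)
    (h0 : Filter.Tendsto f Filter.atTop (nhds 0)) (n : ℕ) :
    HasSum (fun i => f i - f (i + n)) (∑ j ∈ range n, f j) := by
  rw [hasSum_iff_tendsto_nat_of_nonneg fun i => sub_nonneg.2 (hf (Nat.le_add_right i n))]
  have hpartial : ∀ m, ∑ i ∈ range m, (f i - f (i + n)) =
      ∑ j ∈ range n, f j - ∑ j ∈ range n, f (j + m) := fun m => by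
    have hleft := sum_range_add f m n
    have hright := sum_range_add f n m
    rw [add_comm n m] at hright
    simp only [sum_sub_distrib, add_comm _ n, add_comm _ m]
    linarith
  simp only [hpartial]
  simpa using tendsto_const_nhds.sub (tendsto_finsetSum (range n) fun j _ =>
    (h0.comp (Filter.tendsto_add_atTop_nat j)).congr fun m => by simp [add_comm])

theorem tsum_recip_mul_recip (a q : ℕ) :
    ∑' i, recip (a + i + (q + 1)) * recip (a + i) =
      recip q * ∑ j ∈ range (q + 1), recip (a + j) := by
  set f : ℕ → ℝ := fun i => 1 / (((a + i : ℕ) : ℝ) + 1) with hf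
  have hanti : Antitone f := fun i j hij => by
    simp only [hf]
    gcongr
  have hlim : Filter.Tendsto f Filter.atTop (nhds 0) := by
    refine (tendsto_one_div_add_atTop_nhds_zero_nat.comp (Filter.tendsto_add_atTop_nat a)).congr
      fun i => ?_
    simp [hf, add_comm]
  have hterm : ∀ i, recip (a + i + (q + 1)) * recip (a + i) =
      recip q * ENNReal.ofReal (f i - f (i + (q + 1))) := fun i => by
    simp only [recip_eq_ofReal, hf]
    rw [← ENNReal.ofReal_mul (by positivity), ← ENNReal.ofReal_mul (by positivity)]
    congr 1
    push_cast
    field_simp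
    ring
  have hsum := hasSum_sub_add hanti hlim (q + 1)
  simp only [hterm, ENNReal.tsum_mul_left]
  rw [← ENNReal.ofReal_tsum_of_nonneg (fun i => sub_nonneg.2 (hanti (Nat.le_add_right i _)))
    hsum.summable, hsum.tsum_eq, ENNReal.ofReal_sum_of_nonneg fun _ _ => by positivity]
  simp only [recip_eq_ofReal, hf]

theorem sum_range_kern (a q : ℕ) :
    ∑ r ∈ range q, kern (q + a) r = ∑ j ∈ range q, recip (a + j) := by
  rw [← sum_range_reflect]
  refine sum_congr rfl fun j hj => ?_
  have hjq := mem_range.1 hj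
  rw [← kern_add (q - 1 - j)]
  congr 1
  lia

theorem tsum_sum_range_comm (g : ℕ → ℕ → ℝ≥0∞) :
    ∑' p, ∑ r ∈ range p, g p r = ∑' r, ∑' i, g (r + 1 + i) r := by
  have hindicator : ∀ p, ∑ r ∈ range p, g p r = ∑' r, if r < p then g p r else 0 := fun p => by
    rw [tsum_eq_sum (s := range p) (by simp_all)]
    exact sum_congr rfl fun r hr => by rw [if_pos (mem_range.1 hr)]
  simp only [hindicator]
  rw [ENNReal.tsum_comm]
  refine tsum_congr fun r => ?_
  rw [← (add_right_injective (r + 1)).tsum_eq]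
  · exact tsum_congr fun i => if_pos (by lia)
  · intro p hp
    have hrp : r < p := by
      by_contra hc
      simp [hc] at hp
    exact ⟨p - (r + 1), by simp only; lia⟩

theorem tsum_recip_mul_kern (q a : ℕ) :
    ∑' i, recip (q + a + 1 + i) * kern (q + a + 1 + i) q =
      letterOp recip 0 Letter.y (kern (q + a)) q + recip (q + a) * recip q := by
  have hterm : ∀ i, recip (q + a + 1 + i) * kern (q + a + 1 + i) q =
      recip (a + i + (q + 1)) * recip (a + i) := fun i => by
    rw [show q + a + 1 + i = q + (a + i) + 1 by ring, kern_add,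
      show q + (a + i) + 1 = a + i + (q + 1) by ring]
  simp only [hterm]
  rw [tsum_recip_mul_recip, sum_range_succ, letterOp_y_apply, add_zero, sum_range_kern, mul_add,
    mul_comm (recip (q + a)), add_comm q a]

theorem connSum_cons_y (w : List Letter) :
    connSum (Letter.y :: w) = connSum (w ++ [Letter.y]) + recipSum (wordOp recip 0 w recip) := by
  calc connSum (Letter.y :: w)
      = ∑' r, ∑' i, recip (r + 1 + i) * wordOp recip 0 w (kern (r + 1 + i)) r := by
        simp only [connSum, wordOp_cons_apply, letterOp_y_apply, add_zero, mul_sum]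
        exact tsum_sum_range_comm _
    _ = ∑' r, wordOp recip 0 w
          (fun q => ∑' i, recip (r + 1 + i) * kern (r + 1 + i) q) r := by
        refine tsum_congr fun r => ?_
        rw [wordOp_tsum]
        refine tsum_congr fun i => ?_
        exact (congrFun (map_smul (wordOp recip 0 w) (recip (r + 1 + i)) _) r).symm
    _ = ∑' r, wordOp recip 0 w (letterOp recip 0 Letter.y (kern r) + recip r • recip) r := by
        refine tsum_congr fun r => wordOp_zero_congr_of_le recip w fun q hq => ?_
        obtain ⟨a, rfl⟩ := Nat.exists_eq_add_of_le hq
        exact tsum_recip_mul_kern q a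
    _ = connSum (w ++ [Letter.y]) + recipSum (wordOp recip 0 w recip) := by
        simp only [connSum, recipSum, map_add, map_smul, Pi.add_apply, Pi.smul_apply, smul_eq_mul,
          ENNReal.tsum_add, wordOp_append_apply, wordOp_singleton_apply]

/-! ### Convergence -/

theorem summable_harmonic_pow_div_sq (k : ℕ) :
    Summable fun n : ℕ => (harmonic n : ℝ) ^ k / (n : ℝ) ^ 2 := by
  have hharmonic : (fun n : ℕ => (harmonic n : ℝ)) =O[Filter.atTop] fun n => Real.log n := by
    have hdiff := Real.tendsto_harmonic_sub_log.isBigO_one ℝ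
    have hconst : (fun _ : ℕ => (1 : ℝ)) =O[Filter.atTop] fun n => Real.log n :=
      (Real.isLittleO_const_log_atTop.comp_tendsto tendsto_natCast_atTop_atTop).isBigO
    simpa using (hdiff.trans hconst).add (Asymptotics.isBigO_refl _ _)
  have hlog : (fun n : ℕ => Real.log n ^ k) =O[Filter.atTop] fun n => (n : ℝ) ^ (1 / 2 : ℝ) := by
    have h := isLittleO_log_rpow_rpow_atTop (k : ℝ) (one_half_pos (α := ℝ))
    simpa only [Function.comp_def, Real.rpow_natCast] using
      (h.comp_tendsto tendsto_natCast_atTop_atTop).isBigO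
  refine summable_of_isBigO_nat (g := fun n : ℕ => (n : ℝ) ^ (-(3 / 2) : ℝ))
    (Real.summable_nat_rpow.2 (by norm_num)) ?_
  refine (((hharmonic.pow k).trans hlog).mul
    (Asymptotics.isBigO_refl (fun n : ℕ => ((n : ℝ) ^ 2)⁻¹) _)).congr'
      (Filter.Eventually.of_forall fun n => (div_eq_mul_inv _ _).symm) ?_
  filter_upwards [Filter.eventually_gt_atTop 0] with n hn
  rw [← Real.rpow_natCast, ← Real.rpow_neg n.cast_nonneg, ← Real.rpow_add (by exact_mod_cast hn)]
  norm_num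

/-- The harmonic numbers `1 + 1/2 + ⋯ + 1/(p+1)`, in the indexing of `recip`. Their powers measure
the growth of the sequences `wordOp recip s w recip`. -/
def harm (p : ℕ) : ℝ≥0∞ := ∑ r ∈ range (p + 1), recip r

theorem harm_mono : Monotone harm := fun _ _ h =>
  sum_le_sum_of_subset (range_mono (by lia))

theorem recip_le_harm (p : ℕ) : recip p ≤ harm p :=
  single_le_sum_of_canonicallyOrdered (self_mem_range_succ p)

theorem harm_eq_ofReal (p : ℕ) : harm p = ENNReal.ofReal (harmonic (p + 1)) := by
  simp only [harm, recip_eq_ofReal]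
  rw [← ENNReal.ofReal_sum_of_nonneg fun _ _ => by positivity]
  simp [harmonic]

theorem recipSum_recip_mul_harm_pow_ne_top (k : ℕ) : recipSum (recip * harm ^ k) ≠ ⊤ := by
  refine ne_of_eq_of_ne (tsum_congr fun p => ?_)
    ((summable_nat_add_iff 1).2 (summable_harmonic_pow_div_sq k)).tsum_ofReal_ne_top
  have hharmonic : (0 : ℝ) ≤ harmonic (p + 1) := by
    exact_mod_cast (harmonic_pos p.succ_ne_zero).le
  simp only [Pi.mul_apply, Pi.pow_apply, recip_eq_ofReal, harm_eq_ofReal]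
  rw [← ENNReal.ofReal_pow hharmonic, ← ENNReal.ofReal_mul (by positivity),
    ← ENNReal.ofReal_mul (by positivity)]
  congr 1
  push_cast
  field_simp

theorem letterOp_recip_mul_harm_pow_le {s : ℕ} (hs : s ≤ 1) (u : Letter) (k : ℕ) :
    letterOp recip s u (recip * harm ^ k) ≤ recip * harm ^ (k + 1) := by
  intro p
  cases u with
  | x =>
    rw [letterOp_x_apply, Pi.mul_apply, Pi.mul_apply, Pi.pow_apply, Pi.pow_apply, pow_succ']
    gcongr
    exact recip_le_harm p
  | y =>
    rw [letterOp_y_apply, Pi.mul_apply]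
    gcongr
    calc ∑ r ∈ range (p + s), (recip * harm ^ k) r
        ≤ ∑ r ∈ range (p + 1), (recip * harm ^ k) r :=
          sum_le_sum_of_subset (range_mono (by lia))
      _ ≤ ∑ r ∈ range (p + 1), recip r * harm p ^ k := by
          refine sum_le_sum fun r hr => ?_
          rw [Pi.mul_apply, Pi.pow_apply]
          gcongr
          exact harm_mono (by simpa [Nat.lt_succ_iff] using hr)
      _ = (harm ^ (k + 1)) p := by rw [← sum_mul, Pi.pow_apply, pow_succ', harm]

theorem wordOp_recip_le {s : ℕ} (hs : s ≤ 1) (w : List Letter) {f : ℕ → ℝ≥0∞} {k : ℕ}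
    (hf : f ≤ recip * harm ^ k) : wordOp recip s w f ≤ recip * harm ^ (k + w.length) := by
  induction w with
  | nil => simpa [wordOp_nil_apply] using hf
  | cons u w ih =>
    rw [wordOp_cons_apply]
    exact (letterOp_mono recip s u ih).trans (letterOp_recip_mul_harm_pow_le hs u _)

theorem recipSum_ne_top_of_le {f : ℕ → ℝ≥0∞} {k : ℕ} (hf : f ≤ recip * harm ^ k) :
    recipSum f ≠ ⊤ :=
  ne_top_of_le_ne_top (recipSum_recip_mul_harm_pow_ne_top k)
    (ENNReal.tsum_le_tsum fun p => by gcongr; exact hf p)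

theorem wordOp_zero_recip_le (w : List Letter) :
    wordOp recip 0 w recip ≤ recip * harm ^ w.length := by
  simpa using wordOp_recip_le zero_le_one w (k := 0) (f := recip) (by simp)

theorem recipSum_wordOp_ne_top (u v : List Letter) :
    recipSum (wordOp recip 1 u (wordOp recip 0 v recip)) ≠ ⊤ :=
  recipSum_ne_top_of_le (wordOp_recip_le le_rfl u (wordOp_zero_recip_le v))

theorem recipSum_wordOp_zero_ne_top (w : List Letter) : recipSum (wordOp recip 0 w recip) ≠ ⊤ :=
  recipSum_ne_top_of_le (wordOp_zero_recip_le w)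

theorem letterOp_kern_le (u : Letter) (p : ℕ) : letterOp recip 0 u (kern p) ≤ harm p • recip := by
  have hsum : ∑ r ∈ range p, kern p r ≤ harm p := by
    have h := sum_range_kern 0 p
    simp only [add_zero, zero_add] at h
    exact h.trans_le (sum_le_sum_of_subset (f := recip) (range_mono p.le_succ))
  refine fun q => le_trans ?_ (mul_le_mul_left hsum (recip q))
  rw [mul_comm]
  cases u with
  | x =>
    rw [letterOp_x_apply]
    gcongr
    by_cases h : q < p
    · exact single_le_sum_of_canonicallyOrdered (mem_range.2 h)
    · simp [kern, h]
  | y =>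
    rw [letterOp_y_apply]
    refine mul_le_mul_right (sum_le_sum_of_ne_zero fun r _ hr => ?_) _
    by_contra h
    exact hr (if_neg (by simpa using h))

theorem connSum_cons_x_ne_top (w : List Letter) : connSum (Letter.x :: w) ≠ ⊤ := by
  rcases List.eq_nil_or_concat w with rfl | ⟨w, u, rfl⟩
  · simp [connSum, wordOp_singleton_apply, letterOp_x_apply, kern]
  · refine ne_top_of_le_ne_top (recipSum_recip_mul_harm_pow_ne_top (w.length + 1))
      (ENNReal.tsum_le_tsum fun p => ?_)
    rw [List.concat_eq_append, wordOp_cons_apply, letterOp_x_apply, wordOp_append_apply,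
      wordOp_singleton_apply]
    gcongr
    calc wordOp recip 0 w (letterOp recip 0 u (kern p)) p
        ≤ wordOp recip 0 w (harm p • recip) p := wordOp_mono recip 0 w (letterOp_kern_le u p) p
      _ = harm p * wordOp recip 0 w recip p := by rw [map_smul, Pi.smul_apply, smul_eq_mul]
      _ ≤ harm p * (recip * harm ^ w.length) p := by
          gcongr
          exact wordOp_zero_recip_le w p
      _ = (recip * harm ^ (w.length + 1)) p := by
          simp only [Pi.mul_apply, Pi.pow_apply]
          ring

/-- Rotating the word changes the connected sum by a finite amount, so one may assume that it
starts with `x`. -/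
theorem connSum_ne_top {w : List Letter} (hx : Letter.x ∈ w) (hy : Letter.y ∈ w) :
    connSum w ≠ ⊤ := by
  obtain ⟨v, v', rfl⟩ := List.append_of_mem hx
  clear hx
  induction v generalizing v' with
  | nil => exact connSum_cons_x_ne_top v'
  | cons u v ih =>
    have hrotated := ih (v' ++ [u]) (by
      simp only [List.mem_append, List.mem_cons] at hy ⊢
      tauto)
    rw [← List.cons_append, ← List.append_assoc] at hrotated
    rw [List.cons_append]
    cases u with
    | x =>
      rw [connSum_append_x (by simpa using hy)] at hrotated
      exact (ENNReal.add_ne_top.1 hrotated).1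
    | y =>
      rw [connSum_cons_y]
      exact ENNReal.add_ne_top.2 ⟨hrotated, recipSum_wordOp_zero_ne_top _⟩

/-! ### Zeta-star values as iterated sums -/

/-- The sum of `∏ (m_i + 1)^{-k_i}` over the sequences `N ≥ m_1 ≥ ⋯ ≥ m_l ≥ 0`. -/
def boundedStarSum : List ℕ → ℕ → ℝ≥0∞
  | [], _ => 1
  | a :: k, N => ∑ p ∈ range (N + 1), recip p ^ a * boundedStarSum k p

theorem tsum_antitone_succ {α : Type*} [Preorder α] {l : ℕ} (s : Set α)
    (f : (Fin (l + 1) → α) → ℝ≥0∞) :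
    ∑' m : {m : Fin (l + 1) → α // m 0 ∈ s ∧ Antitone m}, f m =
      ∑' p : s, ∑' m : {m : Fin l → α // Antitone (Matrix.vecCons (p : α) m)},
        f (Matrix.vecCons p m) := by
  let e : (Σ p : s, {m : Fin l → α // Antitone (Matrix.vecCons (p : α) m)}) ≃
      {m : Fin (l + 1) → α // m 0 ∈ s ∧ Antitone m} :=
    { toFun := fun m => ⟨Matrix.vecCons m.1 m.2, m.1.2, m.2.2⟩
      invFun := fun m => ⟨⟨m.1 0, m.2.1⟩, Matrix.vecTail m.1, by
        simpa only [← Matrix.vecHead.eq_1, Matrix.cons_head_tail] using m.2.2⟩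
      left_inv := fun m => rfl
      right_inv := fun m => Subtype.ext (Matrix.cons_head_tail m.1) }
  rw [← e.tsum_eq, ENNReal.tsum_sigma']
  rfl

theorem tsum_antitone_prod_cons (s : Set ℕ) (a : ℕ) (k : List ℕ) :
    ∑' m : {m : Fin (a :: k).length → ℕ // m 0 ∈ s ∧ Antitone m},
        ∏ i, recip (m.1 i) ^ (a :: k).get i =
      ∑' p : s, recip p ^ a *
        ∑' m : {m : Fin k.length → ℕ // Antitone (Matrix.vecCons (p : ℕ) m)},
          ∏ i, recip (m.1 i) ^ k.get i := by
  refine (tsum_antitone_succ (l := k.length) s fun m =>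
    ∏ i, recip (m i) ^ (a :: k).get i).trans (tsum_congr fun p => ?_)
  rw [← ENNReal.tsum_mul_left]
  exact tsum_congr fun m => Fin.prod_univ_succ _

theorem tsum_antitone_vecCons (k : List ℕ) (N : ℕ) :
    ∑' m : {m : Fin k.length → ℕ // Antitone (Matrix.vecCons N m)},
      ∏ i, recip (m.1 i) ^ k.get i = boundedStarSum k N := by
  induction k generalizing N with
  | nil =>
    have : Unique {m : Fin ([] : List ℕ).length → ℕ // Antitone (Matrix.vecCons N m)} :=
      { default := ⟨fun i => i.elim0, Subsingleton.antitone (α := Fin 1) _⟩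
        uniq := fun m => Subtype.ext (funext fun i => i.elim0) }
    rw [tsum_fintype, Fintype.sum_unique]
    rfl
  | cons a k ih =>
    have hmem (m : Fin (a :: k).length → ℕ) :
        m 0 ∈ (range (N + 1) : Set ℕ) ∧ Antitone m ↔ Antitone (Matrix.vecCons N m) := by
      rw [mem_coe, mem_range, Nat.lt_succ_iff]
      exact antitone_vecCons.symm
    refine ((Equiv.subtypeEquivRight hmem).tsum_eq _).symm.trans
      ((tsum_antitone_prod_cons _ a k).trans ?_)
    simp only [ih]
    exact Finset.tsum_subtype' (range (N + 1)) fun p => recip p ^ a * boundedStarSum k p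

theorem zetaStar_eq_toReal (k : List ℕ) :
    zetaStar k =
      (∑' m : {m : Fin k.length → ℕ // Antitone m}, ∏ i, recip (m.1 i) ^ k.get i).toReal := by
  let e : {m : Fin k.length → ℕ // Antitone m} ≃ {m : Fin k.length → ℕ+ // Antitone m} :=
    (Equiv.arrowCongr (Equiv.refl _) Equiv.pnatEquivNat.symm).subtypeEquiv fun m =>
      forall₃_congr fun i j _ => Nat.succPNat_le_succPNat.symm
  have hterm : ∀ m, (∏ i, recip (m.1 i) ^ k.get i).toReal =
      ∏ i, 1 / (((e m).1 i : ℕ) : ℝ) ^ k.get i := fun m => by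
    rw [ENNReal.toReal_prod]
    refine prod_congr rfl fun i _ => ?_
    rw [recip, ENNReal.toReal_pow, ENNReal.toReal_inv, ENNReal.toReal_natCast, one_div, inv_pow]
    rfl
  have hfinite : ∀ m : {m : Fin k.length → ℕ // Antitone m},
      ∏ i, recip (m.1 i) ^ k.get i ≠ ⊤ := fun m =>
    ENNReal.prod_ne_top fun i _ => ENNReal.pow_ne_top
      (ne_top_of_le_ne_top ENNReal.one_ne_top (recip_le_one _))
  rw [ENNReal.tsum_toReal_eq hfinite, tsum_congr hterm]
  exact (e.tsum_eq _).symm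

theorem zetaStar_cons (a : ℕ) (k : List ℕ) :
    zetaStar (a :: k) = (∑' p, recip p ^ a * boundedStarSum k p).toReal := by
  rw [zetaStar_eq_toReal, ← tsum_univ fun p => recip p ^ a * boundedStarSum k p]
  simp only [← tsum_antitone_vecCons]
  rw [← tsum_antitone_prod_cons]
  congr 1
  exact ((Equiv.subtypeEquivRight fun m => and_iff_right (Set.mem_univ (m 0))).tsum_eq _).symm

theorem exponentsAux_append_y (c : ℕ) (u : List Letter) :
    ∃ a k, exponentsAux c (u ++ [Letter.y]) = a :: k ∧
      ∀ p, recip p ^ a * boundedStarSum k p = recip p ^ c * wordOp recip 1 u recip p := by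
  induction u generalizing c with
  | nil => exact ⟨c + 1, [], rfl, fun p => by
      rw [boundedStarSum, wordOp_nil_apply, pow_succ, mul_one]⟩
  | cons b u ih =>
    cases b with
    | x =>
      obtain ⟨a, k, hk, hsum⟩ := ih (c + 1)
      refine ⟨a, k, hk, fun p => ?_⟩
      rw [hsum, wordOp_cons_apply, letterOp_x_apply, pow_succ, mul_assoc]
    | y =>
      obtain ⟨a, k, hk, hsum⟩ := ih 0
      refine ⟨c + 1, a :: k, by rw [List.cons_append, exponentsAux, hk], fun p => ?_⟩
      simp only [boundedStarSum, hsum, pow_zero, one_mul]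
      rw [wordOp_cons_apply, letterOp_y_apply, pow_succ, mul_assoc]

theorem zetaStar_exponents (u : List Letter) :
    zetaStar (exponents (Letter.x :: (u ++ [Letter.y]))) =
      (recipSum (wordOp recip 1 u recip)).toReal := by
  obtain ⟨a, k, hk, hsum⟩ := exponentsAux_append_y 1 u
  rw [exponents, exponentsAux, hk, zetaStar_cons]
  simp only [hsum, pow_one, recipSum]

/-- The linear extension of `Z̄` to `ℚ⟨x, y⟩`, with the exponents read off an arbitrary word. -/
def ZbarExt : H →ₗ[ℚ] ℝ := wordBasis.constr ℚ (fun w => zetaStar (exponents w.toList))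

theorem ZbarExt_word (w : List Letter) : ZbarExt (word w) = zetaStar (exponents w) := by
  have h := wordBasis.constr_basis ℚ (fun w => zetaStar (exponents w.toList)) (FreeMonoid.ofList w)
  rwa [wordBasis_apply] at h

theorem ZbarExt_zWord (k : List ℕ) (hk : ∀ a ∈ k, 1 ≤ a) : ZbarExt (zWord k) = zetaStar k := by
  obtain ⟨w, hword, hexponents⟩ := zWord_eq_word k hk
  rw [hword, ZbarExt_word, hexponents]

theorem γ_symm_x : γ.symm x = x := by rw [AlgEquiv.symm_apply_eq, γ_x]

theorem γ_symm_y : γ.symm y = y - x := by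
  rw [AlgEquiv.symm_apply_eq, map_sub, γ_x, γ_y, add_sub_cancel_left]

theorem word_singleton (u : Letter) : word [u] = FreeAlgebra.ι ℚ u := by simp [word]

/-- By `letterOp_one_y`, replacing `y` by `y - x = γ⁻¹(y)` turns weak inequalities into strict
ones. -/
theorem ZbarExt_x_mul_word_mul_γ_symm_word_mul_y (u v : List Letter) :
    ZbarExt (x * (word u * γ.symm (word v)) * y) =
      (recipSum (wordOp recip 1 u (wordOp recip 0 v recip))).toReal := by
  induction v generalizing u with
  | nil =>
    rw [word_nil, map_one, mul_one, wordOp_nil_apply, ← zetaStar_exponents, ← ZbarExt_word,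
      word_cons, word_append, word_singleton, ← mul_assoc]
    rfl
  | cons b v ih =>
    have hsnoc (b : Letter) : ZbarExt (x * (word u * (FreeAlgebra.ι ℚ b * γ.symm (word v))) * y) =
        (recipSum (wordOp recip 1 u (letterOp recip 1 b (wordOp recip 0 v recip)))).toReal := by
      rw [← mul_assoc (word u), ← word_singleton, ← word_append, ih, wordOp_append_apply,
        wordOp_singleton_apply]
    rw [word_cons, map_mul γ.symm, wordOp_cons_apply]
    cases b with
    | x =>
      change ZbarExt (x * (word u * (γ.symm x * γ.symm (word v))) * y) = _
      rw [γ_symm_x]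
      exact hsnoc Letter.x
    | y =>
      have hfinite (b : Letter) := recipSum_wordOp_ne_top u (b :: v)
      simp only [wordOp_cons_apply] at hfinite
      have hy := hsnoc Letter.y
      rw [letterOp_one_y, LinearMap.add_apply, map_add, recipSum_add,
        ENNReal.toReal_add (hfinite _) (hfinite _)] at hy
      change ZbarExt (x * (word u * (γ.symm y * γ.symm (word v))) * y) = _
      rw [γ_symm_y, sub_mul, mul_sub, mul_sub, sub_mul, map_sub, sub_eq_iff_eq_add]
      exact hy.trans (congrArg _ (hsnoc Letter.x).symm)

theorem ZbarExt_x_mul_γ_symm_word_mul_y (w : List Letter) :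
    ZbarExt (x * γ.symm (word w) * y) = (recipSum (wordOp recip 0 w recip)).toReal := by
  simpa only [word_nil, one_mul, wordOp_nil_apply] using
    ZbarExt_x_mul_word_mul_γ_symm_word_mul_y [] w

/-! ### The operators `ρ̄_n` -/

theorem M_lact_ract_xyTensor (n : ℕ) (a b : H) :
    M (n + 1) (lact (n + 1) a (ract (n + 1) b (xyTensor (n + 1)))) = x * b * y ^ n * a * y := by
  rw [xyTensor, ract_tprod, lact_tprod, M_tprod, List.ofFn_succ, List.ofFn_succ']
  simp [← Fin.succ_last, Function.update_of_ne (Fin.succ_ne_zero _).symm, List.ofFn_const,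
    mul_assoc, List.concat_eq_append]

/-- The map `v ↦ M_n(a ⋄ 𝒞̄_n(v) ⋄ b)`. Unlike `ρ̄_n` alone, these maps satisfy a Leibniz rule
among themselves, `rhobarAct_mul`. -/
def rhobarAct (n : ℕ) (a b : H) : H →ₗ[ℚ] H := M n ∘ₗ lact n a ∘ₗ ract n b ∘ₗ Cbar n

theorem rhobarAct_one_one (n : ℕ) : rhobarAct n 1 1 = rhobar n :=
  LinearMap.ext fun v => by
    simp only [rhobarAct, rhobar, LinearMap.comp_apply, lact_one, ract_one]

theorem rhobarAct_mul (n : ℕ) (a b v w : H) :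
    rhobarAct n a b (v * w) = rhobarAct n a (γ.symm w * b) v + rhobarAct n (a * γ.symm v) b w := by
  simp only [rhobarAct, LinearMap.comp_apply, Cbar_mul, map_add, ract_mul, lact_mul, lact_ract]

theorem rhobarAct_one (n : ℕ) (a b : H) : rhobarAct n a b 1 = 0 := by
  rw [rhobarAct, LinearMap.comp_apply, LinearMap.comp_apply, LinearMap.comp_apply, ← word_nil,
    Cbar_word, CbarWord, map_zero, map_zero, map_zero]

theorem rhobarAct_x (n : ℕ) (a b : H) :
    rhobarAct (n + 1) a b x = x * b * y ^ n * a * y := by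
  rw [← M_lact_ract_xyTensor, ← Cbar_x]
  rfl

theorem rhobarAct_x_add_y (n : ℕ) (a b : H) : rhobarAct n a b (x + y) = 0 := by
  rw [rhobarAct, LinearMap.comp_apply, LinearMap.comp_apply, LinearMap.comp_apply, map_add, Cbar_x,
    Cbar_y, add_neg_cancel, map_zero, map_zero, map_zero]

theorem rhobarAct_y (n : ℕ) (a b : H) :
    rhobarAct (n + 1) a b y = -(x * b * y ^ n * a * y) := by
  rw [eq_neg_iff_add_eq_zero, ← rhobarAct_x, ← map_add, add_comm y x, rhobarAct_x_add_y]

theorem ZbarExt_rhobarAct_word (v w : List Letter) (hx : Letter.x ∈ v ++ w)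
    (hy : Letter.y ∈ v ++ w) :
    ZbarExt (rhobarAct 1 (γ.symm (word v)) 1 (word w)) =
      (connSum (v ++ w)).toReal - (connSum (w ++ v)).toReal := by
  induction w generalizing v with
  | nil => simp [word_nil, rhobarAct_one]
  | cons u w ih =>
    have hrotated := ih (v ++ [u]) (by simpa using hx) (by simpa using hy)
    rw [List.append_assoc, List.singleton_append, ← List.append_assoc] at hrotated
    have hword : ZbarExt (x * γ.symm (word w) * γ.symm (word v) * y) =
        (recipSum (wordOp recip 0 (w ++ v) recip)).toReal := by
      rw [mul_assoc x, ← map_mul, ← word_append, ZbarExt_x_mul_γ_symm_word_mul_y]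
    have hsum := recipSum_wordOp_zero_ne_top (w ++ v)
    rw [word_cons, rhobarAct_mul, map_add, ← word_singleton, ← map_mul γ.symm, ← word_append,
      hrotated, mul_one, word_singleton, List.cons_append]
    have hmem : Letter.x ∈ u :: (w ++ v) ∧ Letter.y ∈ u :: (w ++ v) := by
      simp only [List.mem_append, List.mem_cons] at hx hy ⊢
      tauto
    cases u with
    | x =>
      have hfinite := connSum_ne_top hmem.1 hmem.2
      change ZbarExt (rhobarAct (0 + 1) _ _ x) + _ = _
      rw [rhobarAct_x, pow_zero, mul_one, hword, connSum_append_x (by simpa using hmem.2),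
        ENNReal.toReal_add hfinite hsum]
      ring
    | y =>
      have hfinite : connSum ((w ++ v) ++ [Letter.y]) ≠ ⊤ :=
        connSum_ne_top (by simpa using hmem.1) (by simp)
      change ZbarExt (rhobarAct (0 + 1) _ _ y) + _ = _
      rw [rhobarAct_y, map_neg, pow_zero, mul_one, hword, connSum_cons_y,
        ENNReal.toReal_add hfinite hsum]
      ring

theorem ZbarExt_rhobar_one_word {w : List Letter} (hx : Letter.x ∈ w) (hy : Letter.y ∈ w) :
    ZbarExt (rhobar 1 (word w)) = 0 := by
  simpa [word_nil, rhobarAct_one_one] using ZbarExt_rhobarAct_word [] w hx hy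

theorem rhobarAct_mem_H0 (n : ℕ) (a b v : H) : rhobarAct (n + 1) a b v ∈ H0 := by
  have hmem (c : H) : x * c * y ∈ H0 := Submodule.mem_sup_right ⟨c, (mul_assoc x c y).symm⟩
  induction v using FreeAlgebra.induction generalizing a b with
  | grade0 r =>
    rw [Algebra.algebraMap_eq_smul_one, map_smul, rhobarAct_one, smul_zero]
    exact H0.zero_mem
  | grade1 u =>
    cases u with
    | x =>
      change rhobarAct (n + 1) a b x ∈ H0
      rw [rhobarAct_x, mul_assoc x, mul_assoc x]
      exact hmem _
    | y =>
      change rhobarAct (n + 1) a b y ∈ H0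
      rw [rhobarAct_y, mul_assoc x, mul_assoc x]
      exact H0.neg_mem (hmem _)
  | mul v w hv hw => rw [rhobarAct_mul]; exact H0.add_mem (hv _ _) (hw _ _)
  | add v w hv hw => rw [map_add]; exact H0.add_mem (hv _ _) (hw _ _)

theorem rhobarAct_succ (n : ℕ) (a b v : H) :
    rhobarAct (n + 1) a b v = rhobarAct 1 a (b * y ^ n) v := by
  induction v using FreeAlgebra.induction generalizing a b with
  | grade0 r => simp only [Algebra.algebraMap_eq_smul_one, map_smul, rhobarAct_one]
  | grade1 u =>
    cases u with
    | x =>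
      change rhobarAct (n + 1) a b x = rhobarAct (0 + 1) a _ x
      rw [rhobarAct_x, rhobarAct_x, pow_zero, mul_one, ← mul_assoc]
    | y =>
      change rhobarAct (n + 1) a b y = rhobarAct (0 + 1) a _ y
      rw [rhobarAct_y, rhobarAct_y, pow_zero, mul_one, ← mul_assoc]
  | mul v w hv hw => rw [rhobarAct_mul, rhobarAct_mul, hv, hw, mul_assoc]
  | add v w hv hw => rw [map_add, map_add, hv, hw]

theorem rhobarAct_mul_x_add_y_pow (n m : ℕ) (a b v : H) :
    rhobarAct n a b (v * (x + y) ^ m) = rhobarAct n a (y ^ m * b) v := by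
  induction m generalizing b with
  | zero => rw [pow_zero, mul_one, pow_zero, one_mul]
  | succ m ih =>
    rw [pow_succ, ← mul_assoc, rhobarAct_mul, rhobarAct_x_add_y, add_zero, ih, ← γ_y,
      AlgEquiv.symm_apply_apply, ← mul_assoc, pow_succ]

theorem rhobar_succ (n : ℕ) (v : H) : rhobar (n + 1) v = rhobar 1 (v * (x + y) ^ n) := by
  rw [← rhobarAct_one_one, ← rhobarAct_one_one, rhobarAct_mul_x_add_y_pow, rhobarAct_succ, one_mul,
    mul_one]

/-! ### Words containing both letters -/

/-- The algebra homomorphism substituting `a` for `x` and `b` for `y`. -/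
def subst {A : Type*} [Ring A] [Algebra ℚ A] (a b : A) : H →ₐ[ℚ] A :=
  FreeAlgebra.lift ℚ fun
    | Letter.x => a
    | Letter.y => b

section Subst

variable {A : Type*} [Ring A] [Algebra ℚ A] (a b a' b' : A)

theorem subst_x : subst a b x = a := FreeAlgebra.lift_ι_apply _ _

theorem subst_y : subst a b y = b := FreeAlgebra.lift_ι_apply _ _

theorem subst_word_congr_left {w : List Letter} (hw : Letter.x ∉ w) :
    subst a b (word w) = subst a' b (word w) := by
  induction w with
  | nil => rw [word_nil, map_one, map_one]
  | cons u w ih =>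
    simp only [List.mem_cons, not_or] at hw
    rw [word_cons, map_mul, map_mul, ih hw.2]
    cases u with
    | x => exact absurd rfl hw.1
    | y => exact congrArg (· * _) ((subst_y a b).trans (subst_y a' b).symm)

theorem subst_word_congr_right {w : List Letter} (hw : Letter.y ∉ w) :
    subst a b (word w) = subst a b' (word w) := by
  induction w with
  | nil => rw [word_nil, map_one, map_one]
  | cons u w ih =>
    simp only [List.mem_cons, not_or] at hw
    rw [word_cons, map_mul, map_mul, ih hw.2]
    cases u with
    | x => exact congrArg (· * _) ((subst_x a b).trans (subst_x a b').symm)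
    | y => exact absurd rfl hw.1

theorem subst_word_of_x_mem {w : List Letter} (hw : Letter.x ∈ w) : subst 0 b (word w) = 0 := by
  obtain ⟨v, v', rfl⟩ := List.append_of_mem hw
  rw [word_append, word_cons, map_mul, map_mul]
  change _ * (subst 0 b x * _) = _
  rw [subst_x, zero_mul, mul_zero]

theorem subst_word_of_y_mem {w : List Letter} (hw : Letter.y ∈ w) : subst a 0 (word w) = 0 := by
  obtain ⟨v, v', rfl⟩ := List.append_of_mem hw
  rw [word_append, word_cons, map_mul, map_mul]
  change _ * (subst a 0 y * _) = _
  rw [subst_y, zero_mul, mul_zero]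

end Subst

theorem subst_x_y (v : H) : subst x y v = v := by
  have h : subst x y = AlgHom.id ℚ H := by
    ext u
    cases u with
    | x => exact subst_x x y
    | y => exact subst_y x y
  rw [h, AlgHom.id_apply]

theorem subst_zero_zero_subst_x_zero (v : H) :
    subst (0 : H) 0 (subst x 0 v) = subst 0 0 v := by
  have h : (subst (0 : H) 0).comp (subst x 0) = subst 0 0 := by
    ext u
    cases u with
    | x =>
      change subst (0 : H) 0 (subst x 0 x) = subst 0 0 x
      rw [subst_x]
    | y =>
      change subst (0 : H) 0 (subst x 0 y) = subst 0 0 y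
      rw [subst_y, map_zero, subst_y]
  exact DFunLike.congr_fun h v

theorem subst_eq_of_mem_H1 {A : Type*} [Ring A] [Algebra ℚ A] (a a' : A) {v : H} (hv : v ∈ H1) :
    subst a 0 v = subst a' 0 v := by
  obtain ⟨c, hc, d, ⟨e, rfl⟩, rfl⟩ := Submodule.mem_sup.1 hv
  obtain ⟨t, rfl⟩ := Submodule.mem_span_singleton.1 hc
  simp [subst_y]

/-- The elements that vanish when either letter is set to `0`: by `mixed_le_span_word` these are the
linear combinations of words containing both letters. -/
def mixed : Submodule ℚ H :=
  LinearMap.ker (subst x 0).toLinearMap ⊓ LinearMap.ker (subst 0 y).toLinearMap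

theorem mem_mixed {v : H} : v ∈ mixed ↔ subst x 0 v = 0 ∧ subst 0 y v = 0 := Iff.rfl

theorem mem_of_forall_word_mem {S : Submodule ℚ H} (hS : ∀ w, word w ∈ S) (v : H) : v ∈ S := by
  refine Submodule.span_le.2 ?_ (wordBasis.mem_span v)
  rintro _ ⟨w, rfl⟩
  exact wordBasis_apply w ▸ hS _

theorem mixed_le_span_word :
    mixed ≤ Submodule.span ℚ (word '' {w | Letter.x ∈ w ∧ Letter.y ∈ w}) := by
  set S := Submodule.span ℚ (word '' {w | Letter.x ∈ w ∧ Letter.y ∈ w})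
  let removePure : H →ₗ[ℚ] H := LinearMap.id + (subst 0 0).toLinearMap -
    (subst x 0).toLinearMap - (subst 0 y).toLinearMap
  have hword (w : List Letter) : removePure (word w) ∈ S := by
    change word w + subst 0 0 (word w) - subst x 0 (word w) - subst 0 y (word w) ∈ S
    by_cases hx : Letter.x ∈ w
    · by_cases hy : Letter.y ∈ w
      · rw [subst_word_of_x_mem 0 hx, subst_word_of_y_mem x hy, subst_word_of_x_mem y hx, add_zero,
          sub_zero, sub_zero]
        exact Submodule.subset_span ⟨w, ⟨hx, hy⟩, rfl⟩
      · rw [subst_word_congr_right 0 0 y hy, subst_word_congr_right x 0 y hy, subst_x_y,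
          add_sub_cancel_left, sub_self]
        exact S.zero_mem
    · rw [subst_word_congr_left 0 0 x hx, subst_word_congr_left 0 y x hx, subst_x_y,
        add_sub_cancel_right, sub_self]
      exact S.zero_mem
  intro v hv
  have hsub : removePure v = v := by
    change v + subst 0 0 v - subst x 0 v - subst 0 y v = v
    rw [← subst_zero_zero_subst_x_zero, (mem_mixed.1 hv).1, (mem_mixed.1 hv).2, map_zero,
      add_zero, sub_zero, sub_zero]
  exact hsub ▸ mem_of_forall_word_mem (S := S.comap removePure) hword v

theorem mixed_mul {v : H} (hv : v ∈ mixed) (w : H) : v * w ∈ mixed := by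
  rw [mem_mixed] at hv ⊢
  rw [map_mul, map_mul, hv.1, hv.2, zero_mul, zero_mul]
  exact ⟨rfl, rfl⟩

theorem word_eq_x_pow {w : List Letter} (hw : Letter.y ∉ w) : word w = x ^ w.length := by
  have hreplicate : w = List.replicate w.length Letter.x :=
    List.eq_replicate_iff.2 ⟨rfl, fun u hu => by cases u <;> simp_all⟩
  rw [hreplicate]
  simp [word, x]

theorem word_eq_y_pow {w : List Letter} (hw : Letter.x ∉ w) : word w = y ^ w.length := by
  have hreplicate : w = List.replicate w.length Letter.y :=
    List.eq_replicate_iff.2 ⟨rfl, fun u hu => by cases u <;> simp_all⟩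
  rw [hreplicate]
  simp [word, y]

theorem H1Check_le_mixed : H1Check ≤ mixed := by
  refine Submodule.span_le.2 ?_
  rintro _ ⟨hH1, ⟨w, rfl⟩, hpow⟩
  have hx : Letter.x ∈ w := by
    by_contra h
    exact hpow _ (word_eq_y_pow h)
  have hy : Letter.y ∈ w := by
    by_contra h
    have heval := subst_eq_of_mem_H1 (1 : ℚ) 0 hH1
    rw [subst_word_of_x_mem _ hx, word_eq_x_pow h, map_pow, subst_x, one_pow] at heval
    exact one_ne_zero heval
  exact mem_mixed.2 ⟨subst_word_of_y_mem _ hy, subst_word_of_x_mem _ hx⟩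

theorem ZbarExt_rhobar_one_of_mem_mixed {v : H} (hv : v ∈ mixed) : ZbarExt (rhobar 1 v) = 0 := by
  suffices h : mixed ≤ LinearMap.ker (ZbarExt ∘ₗ rhobar 1) from h hv
  refine mixed_le_span_word.trans (Submodule.span_le.2 ?_)
  rintro _ ⟨w, ⟨hx, hy⟩, rfl⟩
  exact ZbarExt_rhobar_one_word hx hy

theorem map_rhobar_mixed_le {n : ℕ} (hn : 1 ≤ n) :
    Submodule.map (rhobar n) mixed ≤ Submodule.map H0.subtype (LinearMap.ker Zbar) := by
  obtain ⟨n, rfl⟩ := Nat.exists_eq_add_of_le' hn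
  rintro _ ⟨v, hv, rfl⟩
  refine ⟨⟨rhobar (n + 1) v, rhobarAct_one_one (n + 1) ▸ rhobarAct_mem_H0 n 1 1 v⟩, ?_, rfl⟩
  change ZbarExt (rhobar (n + 1) v) = 0
  rw [rhobar_succ]
  exact ZbarExt_rhobar_one_of_mem_mixed (mixed_mul hv _)

/-! ### The cyclic sum formula -/

theorem zWord_cons (c : ℕ) (k : List ℕ) : zWord (c :: k) = z c * zWord k := by simp [zWord]

theorem rhobarAct_γ_mul (n : ℕ) (a b v w : H) :
    rhobarAct n a b (γ (v * w)) = rhobarAct n a (w * b) (γ v) + rhobarAct n (a * v) b (γ w) := by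
  rw [map_mul, rhobarAct_mul, AlgEquiv.symm_apply_apply, AlgEquiv.symm_apply_apply]

theorem rhobarAct_x_pow (n m : ℕ) (a b : H) :
    rhobarAct (n + 1) a b (x ^ m) =
      ∑ i ∈ range m, x ^ (m - i) * b * y ^ n * a * x ^ i * y := by
  induction m generalizing b with
  | zero => rw [pow_zero, rhobarAct_one, range_zero, sum_empty]
  | succ m ih =>
    rw [pow_succ, rhobarAct_mul, ih, rhobarAct_x, sum_range_succ, map_pow, γ_symm_x,
      Nat.add_sub_cancel_left, pow_one]
    simp only [mul_assoc]
    congr 1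
    refine sum_congr rfl fun i hi => ?_
    rw [Nat.succ_sub (mem_range.1 hi).le, pow_succ, mul_assoc]

theorem rhobarAct_γ_z (n c : ℕ) (a b : H) :
    rhobarAct (n + 1) a b (γ (z c)) =
      ∑ i ∈ Icc 1 (c - 1), z (c - i + 1) * b * y ^ n * a * z i := by
  have hIcc : Icc 1 (c - 1) = Ico 1 c := by
    ext i
    simp only [mem_Icc, mem_Ico]
    lia
  rw [z, rhobarAct_γ_mul, γ_y, rhobarAct_x_add_y, add_zero, map_pow, γ_x, rhobarAct_x_pow, hIcc,
    sum_Ico_eq_sum_range]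
  refine sum_congr rfl fun i _ => ?_
  rw [z, z, Nat.add_sub_cancel, Nat.add_sub_cancel_left, Nat.sub_sub]
  simp only [mul_assoc]

theorem rhobarAct_γ_zWord (n : ℕ) (k : List ℕ) (a b : H) :
    rhobarAct (n + 1) a b (γ (zWord k)) =
      ∑ j : Fin k.length, ∑ i ∈ Icc 1 (k.get j - 1),
        z (k.get j - i + 1) * zWord (k.drop (j + 1)) * b * y ^ n * a * zWord (k.take j) * z i := by
  induction k generalizing a b with
  | nil =>
    change rhobarAct (n + 1) a b (γ 1) = ∑ j : Fin 0, _
    rw [map_one, rhobarAct_one, univ_eq_empty, sum_empty]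
  | cons c k ih =>
    rw [zWord_cons, rhobarAct_γ_mul, ih, rhobarAct_γ_z]
    refine Eq.trans ?_ (Fin.sum_univ_succ (n := k.length) _).symm
    congr 1
    · refine sum_congr rfl fun i _ => ?_
      simp [zWord, mul_assoc]
    · refine sum_congr rfl fun j _ => sum_congr rfl fun i _ => ?_
      simp [zWord_cons, mul_assoc]

theorem rhobar_one_γ_zWord (k : List ℕ) :
    rhobar 1 (γ (zWord k)) = ∑ j : Fin k.length, ∑ i ∈ Icc 1 (k.get j - 1),
      zWord (cyclicIndex k j i) := by
  rw [← rhobarAct_one_one, rhobarAct_γ_zWord 0]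
  refine sum_congr rfl fun j _ => sum_congr rfl fun i _ => ?_
  simp [cyclicIndex, zWord, mul_assoc]

theorem rhobar_one_x_pow (m : ℕ) : rhobar 1 (x ^ m) = m • z (m + 1) := by
  have hterm : ∀ i ∈ range m, x ^ (m - i) * 1 * y ^ 0 * 1 * x ^ i * y = z (m + 1) := fun i hi => by
    rw [mul_one, pow_zero, mul_one, mul_one, pow_sub_mul_pow x (mem_range.1 hi).le, z,
      Nat.add_sub_cancel]
  rw [← rhobarAct_one_one, rhobarAct_x_pow 0, sum_congr rfl hterm, sum_const, card_range]

theorem rhobar_one_γ_zWord_sub_x_pow (k : List ℕ) :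
    rhobar 1 (γ (zWord k) - x ^ k.sum) =
      (∑ j : Fin k.length, ∑ i ∈ Icc 1 (k.get j - 1), zWord (cyclicIndex k j i)) -
        k.sum • z (k.sum + 1) := by
  rw [map_sub, rhobar_one_γ_zWord, rhobar_one_x_pow]

theorem subst_x_zero_γ_zWord {k : List ℕ} (hk : ∀ a ∈ k, 1 ≤ a) :
    subst x 0 (γ (zWord k)) = x ^ k.sum := by
  induction k with
  | nil => simp [zWord]
  | cons c k ih =>
    have hc : 1 ≤ c := hk c List.mem_cons_self
    rw [zWord_cons, map_mul, map_mul, ih fun b hb => hk b (List.mem_cons_of_mem _ hb), z, map_mul γ,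
      map_pow, γ_x, γ_y, map_mul, map_pow, map_add, subst_x, subst_y, add_zero, ← pow_succ,
      Nat.sub_add_cancel hc, ← pow_add, List.sum_cons]

theorem subst_zero_y_γ_zWord {k : List ℕ} (hk : ∃ a ∈ k, 1 < a) :
    subst 0 y (γ (zWord k)) = 0 := by
  obtain ⟨a, ha, h⟩ := hk
  obtain ⟨s, t, rfl⟩ := List.append_of_mem ha
  have hz : subst 0 y (γ (z a)) = 0 := by
    rw [z, map_mul γ, map_pow, γ_x, map_mul, map_pow, subst_x, zero_pow (by lia), zero_mul]
  simp [zWord, hz]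

theorem γ_zWord_sub_x_pow_mem_mixed {k : List ℕ} (hpos : ∀ a ∈ k, 1 ≤ a) (hk : ∃ a ∈ k, 1 < a) :
    γ (zWord k) - x ^ k.sum ∈ mixed := by
  have hsum : k.sum ≠ 0 := by
    obtain ⟨a, ha, h⟩ := hk
    have := List.le_sum_of_mem ha
    lia
  rw [mem_mixed, map_sub, map_sub, map_pow, map_pow, subst_x, subst_x, subst_x_zero_γ_zWord hpos,
    subst_zero_y_γ_zWord hk, zero_pow hsum, sub_self, sub_self]
  exact ⟨rfl, rfl⟩

theorem zetaStar_singleton (n : ℕ) : zetaStar [n] = ∑' m : ℕ+, 1 / ((m : ℕ) : ℝ) ^ n := by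
  let e : ℕ+ ≃ {m : Fin 1 → ℕ+ // Antitone m} :=
    (Equiv.funUnique (Fin 1) ℕ+).symm.trans
      (Equiv.subtypeUnivEquiv fun m => Subsingleton.antitone m).symm
  refine (e.tsum_eq _).symm.trans (tsum_congr fun m => ?_)
  exact Fin.prod_univ_one _

theorem cyclicIndex_pos {k : List ℕ} (hk : ∀ a ∈ k, 1 ≤ a) (j : Fin k.length) {i : ℕ}
    (hi : 1 ≤ i) : ∀ a ∈ cyclicIndex k j i, 1 ≤ a := by
  intro a ha
  simp only [cyclicIndex, List.mem_cons, List.mem_append, List.not_mem_nil, or_false] at ha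
  rcases ha with rfl | (hdrop | htake) | rfl
  · exact Nat.le_add_left 1 _
  · exact hk a (List.mem_of_mem_drop hdrop)
  · exact hk a (List.mem_of_mem_take htake)
  · exact hi

theorem sum_zetaStar_cyclicIndex {k : List ℕ} (hpos : ∀ a ∈ k, 1 ≤ a) (hk : ∃ a ∈ k, 1 < a) :
    ∑ j : Fin k.length, ∑ i ∈ Icc 1 (k.get j - 1), zetaStar (cyclicIndex k j i) =
      (k.sum : ℝ) * ∑' m : ℕ+, 1 / ((m : ℕ) : ℝ) ^ (k.sum + 1) := by
  have hcyclic := ZbarExt_rhobar_one_of_mem_mixed (γ_zWord_sub_x_pow_mem_mixed hpos hk)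
  have hz : z (k.sum + 1) = zWord [k.sum + 1] := by simp [zWord]
  rw [rhobar_one_γ_zWord_sub_x_pow, map_sub, sub_eq_zero, map_nsmul, hz, ZbarExt_zWord _ (by simp),
    zetaStar_singleton, nsmul_eq_mul] at hcyclic
  simp only [← hcyclic, map_sum]
  refine sum_congr rfl fun j _ => sum_congr rfl fun i hi => ?_
  rw [ZbarExt_zWord _ (cyclicIndex_pos hpos j (mem_Icc.1 hi).1)]

end CSF

end

theorem mainTheorem2 :
    (∀ n : ℕ, 1 ≤ n →
      Submodule.map (CSF.rhobar n) CSF.H1Check ≤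
        Submodule.map CSF.H0.subtype (LinearMap.ker CSF.Zbar)) ∧
    (∀ k : List ℕ, (∀ a ∈ k, 1 ≤ a) →
      CSF.rhobar 1 (CSF.γ (CSF.zWord k) - CSF.x ^ k.sum) =
        (∑ j : Fin k.length, ∑ i ∈ Finset.Icc 1 (k.get j - 1),
          CSF.zWord (CSF.cyclicIndex k j i)) - k.sum • CSF.z (k.sum + 1)) ∧
    (∀ k : List ℕ, (∀ a ∈ k, 1 ≤ a) → (∃ a ∈ k, 1 < a) →
      ∑ j : Fin k.length, ∑ i ∈ Finset.Icc 1 (k.get j - 1),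
          CSF.zetaStar (CSF.cyclicIndex k j i) =
        (k.sum : ℝ) * ∑' m : ℕ+, 1 / ((m : ℕ) : ℝ) ^ (k.sum + 1)) :=
  ⟨fun _ hn => (Submodule.map_mono CSF.H1Check_le_mixed).trans (CSF.map_rhobar_mixed_le hn),
    fun k _ => CSF.rhobar_one_γ_zWord_sub_x_pow k,
    fun _ hpos hk => CSF.sum_zetaStar_cyclicIndex hpos hk⟩
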